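/- Let $I,J\in\mathbb N$, let $\mathcal X=\mathbb Z_+^J$ with $|x|=x_1+\dots+x_J$, let $\mathcal L\subseteq\mathbb R^I$, and for every $\lambda\in\mathcal L$ let $X^{(\lambda)}=(X^{(\lambda)}_k)_{k\ge 0}$ be a Markov chain on $\mathcal X$ whose transition probabilities depend measurably on $\lambda$. Let $f:\mathcal X\to[0,\infty)$ be such that the increments are bounded: there is $\phi_f>0$ with $|f(X^{(\lambda)}_{k+1})-f(X^{(\lambda)}_k)|\le\phi_f$ almost surely for all $k$, all $\lambda\in\mathcal L$ and all initial states. Suppose that $\mathcal L$ is $f$-stable: there are $\delta,\sigma,\kappa>0$ such that $$\mathbb E\big[f(X^{(\lambda)}_k)-f(X^{(\lambda)}_0)\,\big|\,X^{(\lambda)}_0=x\big]\le-\delta\sigma\qquad\text{for all }\lambda\in\mathcal L,\ \text{all }x\text{ with }|x|\ge\kappa\text{ and all integers }k\ge\sigma.$$ Fix $\eta,c,d>0$, put $\tau(x)=c f(x)+d$, and let $N(x)\in\mathbb Z_+$ be a rounding of $\tau(x)$, $|N(x)-\tau(x)|<1$. Write $[z]_-=\min\{0,z\}$. Let $S_k=(Y_k,\Lambda_k)_{k\ge0}$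 be a Markov chain on $\mathcal X\times\mathcal L$, with arbitrary initial law, produced by one of the following two algorithms; one step from $(x,\lambda)$ is described. (a) Global search, where $\mathcal L$ is measurable with $0<|\mathcal L|<\infty$ ($|\mathcal L|$ being its Lebesgue measure): sample $\gamma$ uniformly from $\mathcal L$, then $y=X^{(\gamma)}_{N(x)}$ given $X^{(\gamma)}_0=x$; move to $(y,\gamma)$ with probability $e^{\eta[f(y)-f(x)]_-}$ and stay at $(x,\lambda)$ otherwise. (b) Local search, where $\mathcal L$ is finite and every $\lambda\in\mathcal L$ has a neighbourhood $\mathcal B_\lambda\subseteq\mathcal L$ with $\lambda\in\mathcal B_\lambda$: sample $\gamma$ uniformly from $\mathcal B_\lambda$, then, independently, $x'=X^{(\lambda)}_{N(x)}$ given $X^{(\lambda)}_0=x$ and $y=X^{(\gamma)}_{N(x)}$ given $X^{(\gamma)}_0=x$; move to $(y,\gamma)$ with probability $e^{\eta[f(y)-f(x')]_-}$ and to $(x',\lambda)$ otherwise. Let $T_k=\sum_{i=0}^{k-1}\tau(Y_i)$. Then, in both cases, almost surely, $$\lim_{k\to\infty}\frac{f(Y_k)}{T_k}=0 .$$ -/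

import Mathlib

open MeasureTheory ProbabilityTheory Filter
open scoped ENNReal Topology

noncomputable section

namespace StabilitySearch

/-- The state space `ℤ₊ᴶ`. -/
abbrev State (J : ℕ) : Type := Fin J → ℕ

/-- The size `|x| = x₁ + ⋯ + x_J` of a state. -/
def size {J : ℕ} (x : State J) : ℕ := ∑ j, x j

section Chains

variable {J : ℕ} {Θ : Type*} [MeasurableSpace Θ]

/-- A family of Markov chains on `State J`, indexed measurably by `θ : Θ`, is given by the one-step
transition probabilities `P (θ, x)`. `nStep P θ n x` is the law of `X_n^(θ)` given `X_0^(θ) = x`. -/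
def nStep (P : Kernel (Θ × State J) (State J)) (θ : Θ) : ℕ → State J → Measure (State J)
  | 0, x => Measure.dirac x
  | n + 1, x => (nStep P θ n x).bind fun z => P (θ, z)

/-- All the processes `f(X^(θ))` have increments bounded by one common constant. -/
def BoundedIncrements (P : Kernel (Θ × State J) (State J)) (f : State J → ℝ) : Prop :=
  ∃ φ : ℝ, 0 < φ ∧ ∀ (θ : Θ) (x : State J), ∀ᵐ y ∂(P (θ, x)), |f y - f x| ≤ φ

/-- `f`-stability of the whole parameter set: a uniform negative drift of `f(X^(θ))`. -/
def IsFStable (P : Kernel (Θ × State J) (State J)) (f : State J → ℝ) : Prop :=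
  ∃ δ σ κ : ℝ, 0 < δ ∧ 0 < σ ∧ 0 < κ ∧
    ∀ (θ : Θ) (x : State J) (k : ℕ), κ ≤ (size x : ℝ) → σ ≤ (k : ℝ) →
      ∫ y, (f y - f x) ∂(nStep P θ k x) ≤ -(δ * σ)

/-- The Metropolis rule: move from `s` to the proposal `s'` with probability
`exp (η * min 0 (f(s') - f(s)))`, stay at `s` otherwise. -/
def metropolis (η : ℝ) (f : State J → ℝ) (s s' : State J × Θ) : Measure (State J × Θ) :=
  ENNReal.ofReal (Real.exp (η * min 0 (f s'.1 - f s.1))) • Measure.dirac s' +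
    ENNReal.ofReal (1 - Real.exp (η * min 0 (f s'.1 - f s.1))) • Measure.dirac s

/-- One iteration of the global search from `s = (x, λ)`: sample `γ` from the law `U`, sample
`y = X^(γ)_{N(x)}` given `X^(γ)_0 = x`, and compare `(y, γ)` with `(x, λ)`. -/
def globalStep (P : Kernel (Θ × State J) (State J)) (f : State J → ℝ) (η : ℝ)
    (N : State J → ℕ) (U : Measure Θ) (s : State J × Θ) : Measure (State J × Θ) :=
  U.bind fun γ => (nStep P γ (N s.1) s.1).bind fun y => metropolis η f s (y, γ)

/-- One iteration of the local search from `s = (x, λ)`: sample `γ` uniformly from the (finite)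
neighbourhood `B λ`, sample independently `x' = X^(λ)_{N(x)}` and `y = X^(γ)_{N(x)}`, both
started from `x`, and compare `(y, γ)` with `(x', λ)`. -/
def localStep (P : Kernel (Θ × State J) (State J)) (f : State J → ℝ) (η : ℝ)
    (N : State J → ℕ) (B : Θ → Set Θ) (s : State J × Θ) : Measure (State J × Θ) :=
  (uniformOn (B s.2)).bind fun γ => (nStep P s.2 (N s.1) s.1).bind fun x' =>
    (nStep P γ (N s.1) s.1).bind fun y => metropolis η f (x', s.2) (y, γ)

end Chains

/-- The uniform distribution on a set `L ⊆ ℝᴵ` of finite positive Lebesgue measure, as a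
measure on the subtype `L`. -/
def uniformParam {I : ℕ} (L : Set (Fin I → ℝ)) : Measure L :=
  (ProbabilityTheory.cond (volume : Measure (Fin I → ℝ)) L).comap Subtype.val

/-- `S` is a Markov chain with respect to the filtration `ℱ` with transition probabilities `Q`:
the conditional law of `S (k + 1)` given `ℱ k` is `Q (S k)`. The law of `S 0` is arbitrary. -/
structure IsMarkovChain {Ω E : Type*} [mΩ : MeasurableSpace Ω] [MeasurableSpace E]
    (μ : Measure Ω) (ℱ : Filtration ℕ mΩ) (Q : E → Measure E) (S : ℕ → Ω → E) : Prop where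
  adapted : ∀ k, Measurable[ℱ k] (S k)
  transition : ∀ (k : ℕ) (F : Set Ω), MeasurableSet[ℱ k] F → ∀ A : Set E, MeasurableSet A →
    μ (F ∩ S (k + 1) ⁻¹' A) = ∫⁻ ω in F, Q (S k ω) A ∂μ

/-- The total simulated time `T_k = ∑_{i<k} τ(Y_i)` along a path `y`. -/
def totalTime {J : ℕ} (τ : State J → ℝ) (y : ℕ → State J) (k : ℕ) : ℝ :=
  ∑ i ∈ Finset.range k, τ (y i)

end StabilitySearch

end

/-! From a state with `f x` large, a run of about `c * f x` steps lasts long enough for the drift to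
act: `exp (t * f)` contracts geometrically over blocks of steps, so Markov's inequality gives
probability at most `C * exp (-(β * f x))` that the run ends above `f x`, uniformly in the parameter
(`exists_nStep_gt_le`). The Metropolis rule only chooses among the old state and endpoints of such
runs, so at most a factor 2 is lost, whatever the acceptance probabilities (`globalStep_apply_le`,
`localStep_apply_le`).

Hence a rise of `f` at time `k` from a level at least `(2 / β) * log (k + 1)` has probability
O(k⁻²). By Borel–Cantelli, almost surely all late rises start below this level. One step raises `f`
at most affinely, so `f (Y_k)` is O(log k), while `T_k ≥ k * d`. -/

namespace StabilitySearch

/-- An exponential moment bound for a bounded random variable with negative mean. -/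
theorem lintegral_exp_le_of_integral_le {α : Type*} [MeasurableSpace α] {ν : Measure α}
    [IsProbabilityMeasure ν] {Z : α → ℝ} (hZ : AEStronglyMeasurable Z ν) {M q θ : ℝ}
    (hM : ∀ᵐ y ∂ν, |Z y| ≤ M) (hq : ∫ y, Z y ∂ν ≤ -q) (hθ : 0 < θ) (hθM : θ * M ≤ 1)
    (hθq : θ * M ^ 2 ≤ q / 2) :
    ∫⁻ y, ENNReal.ofReal (Real.exp (θ * Z y)) ∂ν ≤ ENNReal.ofReal (Real.exp (-(θ * q / 2))) := by
  have hint : Integrable Z ν :=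
    Integrable.of_bound hZ M (by filter_upwards [hM] with y hy; simpa using hy)
  have hle : ∀ᵐ y ∂ν, Real.exp (θ * Z y) ≤ (1 + θ ^ 2 * M ^ 2) + θ * Z y := by
    filter_upwards [hM] with y hy
    have h1 : |θ * Z y| ≤ 1 := by
      rw [abs_mul, abs_of_pos hθ]
      exact (mul_le_mul_of_nonneg_left hy hθ.le).trans hθM
    have h2 := (abs_le.1 (Real.abs_exp_sub_one_sub_id_le h1)).2
    have h3 : Z y ^ 2 ≤ M ^ 2 := sq_le_sq' (abs_le.1 hy).1 (abs_le.1 hy).2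
    have h4 : (θ * Z y) ^ 2 ≤ θ ^ 2 * M ^ 2 := by
      rw [mul_pow]
      exact mul_le_mul_of_nonneg_left h3 (sq_nonneg θ)
    linarith
  have hint2 : Integrable (fun y => (1 + θ ^ 2 * M ^ 2) + θ * Z y) ν :=
    (integrable_const _).add (hint.const_mul θ)
  calc ∫⁻ y, ENNReal.ofReal (Real.exp (θ * Z y)) ∂ν
      ≤ ∫⁻ y, ENNReal.ofReal ((1 + θ ^ 2 * M ^ 2) + θ * Z y) ∂ν := by
        refine lintegral_mono_ae ?_
        filter_upwards [hle] with y hy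
        exact ENNReal.ofReal_le_ofReal hy
    _ = ENNReal.ofReal (∫ y, ((1 + θ ^ 2 * M ^ 2) + θ * Z y) ∂ν) := by
        rw [ofReal_integral_eq_lintegral_ofReal hint2]
        filter_upwards [hle] with y hy
        exact (Real.exp_pos _).le.trans hy
    _ ≤ ENNReal.ofReal (Real.exp (-(θ * q / 2))) := by
        refine ENNReal.ofReal_le_ofReal ?_
        rw [integral_add (integrable_const _) (hint.const_mul θ), integral_const_mul]
        simp only [integral_const, probReal_univ, smul_eq_mul, one_mul]
        have h1 := Real.add_one_le_exp (-(θ * q / 2))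
        have h2 := mul_le_mul_of_nonneg_left hq hθ.le
        have h3 := mul_le_mul_of_nonneg_left hθq hθ.le
        nlinarith

/-! ### Multi-step transition laws and the exponential Lyapunov function. -/

section NStep

variable {J : ℕ} {Θ : Type*} [MeasurableSpace Θ]

theorem nStep_succ (P : Kernel (Θ × State J) (State J)) (θ : Θ) (n : ℕ) (x : State J) :
    nStep P θ (n + 1) x = (nStep P θ n x).bind fun z => P (θ, z) := rfl

theorem lintegral_nStep_succ (P : Kernel (Θ × State J) (State J)) (θ : Θ) (n : ℕ) (x : State J)
    (g : State J → ℝ≥0∞) :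
    ∫⁻ y, g y ∂(nStep P θ (n + 1) x) = ∫⁻ z, ∫⁻ y, g y ∂(P (θ, z)) ∂(nStep P θ n x) := by
  rw [nStep_succ]
  exact Measure.lintegral_bind Measurable.of_discrete.aemeasurable
    Measurable.of_discrete.aemeasurable

instance isProbabilityMeasure_nStep (P : Kernel (Θ × State J) (State J)) [IsMarkovKernel P]
    (θ : Θ) (n : ℕ) (x : State J) : IsProbabilityMeasure (nStep P θ n x) := by
  induction n with
  | zero => exact Measure.dirac.isProbabilityMeasure
  | succ n ih =>
    refine ⟨?_⟩
    have h := lintegral_nStep_succ P θ n x 1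
    simpa using h

/-- The Chapman–Kolmogorov equation. -/
theorem lintegral_nStep_add (P : Kernel (Θ × State J) (State J)) (θ : Θ) (a b : ℕ) (x : State J)
    (g : State J → ℝ≥0∞) :
    ∫⁻ y, g y ∂(nStep P θ (a + b) x) = ∫⁻ z, ∫⁻ y, g y ∂(nStep P θ b z) ∂(nStep P θ a x) := by
  induction b generalizing g with
  | zero => simp [nStep]
  | succ b ih =>
    rw [← add_assoc, lintegral_nStep_succ, ih]
    simp_rw [lintegral_nStep_succ]

theorem ae_nStep_abs_sub_le {P : Kernel (Θ × State J) (State J)} {f : State J → ℝ} {φ : ℝ}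
    (h : ∀ (θ : Θ) (x : State J), ∀ᵐ y ∂(P (θ, x)), |f y - f x| ≤ φ) (θ : Θ) (n : ℕ)
    (x : State J) : ∀ᵐ y ∂(nStep P θ n x), |f y - f x| ≤ n * φ := by
  induction n with
  | zero => simp [nStep]
  | succ n ih =>
    rw [ae_iff]
    refine le_antisymm ((Measure.bind_apply_le _ MeasurableSet.of_discrete).trans
      (le_of_eq ?_)) zero_le
    rw [lintegral_eq_zero_iff Measurable.of_discrete]
    filter_upwards [ih] with z hz
    have : ∀ᵐ y ∂(P (θ, z)), |f y - f x| ≤ (n + 1 : ℕ) * φ := by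
      filter_upwards [h θ z] with y hy
      have := abs_sub_le (f y) (f z) (f x)
      push_cast
      linarith
    exact ae_iff.1 this

/-- The exponential Lyapunov function contracts, up to an additive constant, along blocks of
`m` steps; this is iterated over `n` blocks. -/
theorem lintegral_nStep_mul_le {P : Kernel (Θ × State J) (State J)} [IsMarkovKernel P]
    {V : State J → ℝ≥0∞} {m : ℕ} {α C₀ C₁ : ℝ≥0∞} {θ : Θ}
    (h : ∀ x, ∫⁻ y, V y ∂(nStep P θ m x) ≤ α * V x + C₀) (hC : α * C₁ + C₀ ≤ C₁)
    (n : ℕ) (x : State J) : ∫⁻ y, V y ∂(nStep P θ (n * m) x) ≤ α ^ n * V x + C₁ := by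
  induction n with
  | zero => simp [nStep]
  | succ n ih =>
    rw [add_mul, one_mul, lintegral_nStep_add]
    calc ∫⁻ z, ∫⁻ y, V y ∂(nStep P θ m z) ∂(nStep P θ (n * m) x)
        ≤ ∫⁻ z, (α * V z + C₀) ∂(nStep P θ (n * m) x) := lintegral_mono h
      _ = α * ∫⁻ z, V z ∂(nStep P θ (n * m) x) + C₀ := by
        rw [lintegral_add_right _ measurable_const, lintegral_const_mul _ Measurable.of_discrete]
        simp
      _ ≤ α * (α ^ n * V x + C₁) + C₀ := by gcongr
      _ = α ^ (n + 1) * V x + (α * C₁ + C₀) := by ring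
      _ ≤ α ^ (n + 1) * V x + C₁ := by gcongr

theorem lintegral_exp_nStep_le {P : Kernel (Θ × State J) (State J)} [IsMarkovKernel P]
    {f : State J → ℝ} {φ : ℝ}
    (h : ∀ (θ : Θ) (x : State J), ∀ᵐ y ∂(P (θ, x)), |f y - f x| ≤ φ) {t : ℝ} (ht : 0 < t)
    (θ : Θ) (n : ℕ) (x : State J) :
    ∫⁻ y, ENNReal.ofReal (Real.exp (t * f y)) ∂(nStep P θ n x) ≤
      ENNReal.ofReal (Real.exp (t * (n * φ))) * ENNReal.ofReal (Real.exp (t * f x)) := by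
  rw [← ENNReal.ofReal_mul (Real.exp_pos _).le, ← Real.exp_add]
  calc ∫⁻ y, ENNReal.ofReal (Real.exp (t * f y)) ∂(nStep P θ n x)
      ≤ ∫⁻ _, ENNReal.ofReal (Real.exp (t * (n * φ) + t * f x)) ∂(nStep P θ n x) := by
        refine lintegral_mono_ae ?_
        filter_upwards [ae_nStep_abs_sub_le h θ n x] with y hy
        refine ENNReal.ofReal_le_ofReal (Real.exp_le_exp.2 ?_)
        have := (abs_le.1 hy).2
        nlinarith
    _ = _ := by simp

/-- Makes `f` bounded on the states where the drift condition says nothing. -/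
theorem finite_setOf_size_lt (κ : ℝ) : {x : State J | (size x : ℝ) < κ}.Finite := by
  refine (Set.finite_Iic (fun _ => ⌈κ⌉₊ : State J)).subset fun x hx j => ?_
  have h1 : x j ≤ size x := Finset.single_le_sum (fun _ _ => Nat.zero_le _) (Finset.mem_univ j)
  have h2 : (size x : ℝ) < ⌈κ⌉₊ := lt_of_lt_of_le hx (Nat.le_ceil κ)
  have h3 : size x < ⌈κ⌉₊ := by exact_mod_cast h2
  exact h1.trans h3.le

/-- Under stability, a run of `N x ≈ c f x` steps raises `f` with a probability that is
exponentially small in `f x`. -/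
theorem exists_nStep_gt_le {P : Kernel (Θ × State J) (State J)} [IsMarkovKernel P]
    {f : State J → ℝ} (hf : ∀ x, 0 ≤ f x) (hinc : BoundedIncrements P f)
    (hstable : IsFStable P f) {c d : ℝ} (hc : 0 < c) (hd : 0 < d) {N : State J → ℕ}
    (hN : ∀ x, |(N x : ℝ) - (c * f x + d)| < 1) :
    ∃ β C : ℝ, 0 < β ∧ 0 ≤ C ∧ ∀ (θ : Θ) (x : State J),
      nStep P θ (N x) x {y | f x < f y} ≤ ENNReal.ofReal (C * Real.exp (-(β * f x))) := by
  obtain ⟨φ, hφ, hφf⟩ := hinc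
  obtain ⟨δ, σ, κ, hδ, hσ, hκ, hdrift⟩ := hstable
  obtain ⟨F, hF⟩ := ((finite_setOf_size_lt (J := J) κ).image f).bddAbove
  set m := ⌈σ⌉₊ with hm
  have hm0 : 0 < m := Nat.ceil_pos.2 hσ
  have hmR : (0 : ℝ) < m := by exact_mod_cast hm0
  set M : ℝ := m * φ with hMdef
  have hM : 0 < M := by positivity
  set q := δ * σ
  have hq : 0 < q := by positivity
  obtain ⟨t, ht, htM, htq⟩ : ∃ t : ℝ, 0 < t ∧ t * M ≤ 1 ∧ t * M ^ 2 ≤ q / 2 := by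
    refine ⟨min (1 / M) (q / 2 / M ^ 2), by positivity, ?_, ?_⟩
    · exact (mul_le_mul_of_nonneg_right (min_le_left _ _) hM.le).trans
        (by rw [div_mul_cancel₀ _ hM.ne'])
    · exact (mul_le_mul_of_nonneg_right (min_le_right _ _) (by positivity)).trans
        (by rw [div_mul_cancel₀ _ (by positivity)])
  set α := t * q / 2 with hα
  have hα0 : 0 < α := by positivity
  set V : State J → ℝ≥0∞ := fun y => ENNReal.ofReal (Real.exp (t * f y)) with hV
  -- Covers starts with `size x < κ`: there `f x ≤ F`, and `m` steps add at most `M`.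
  set C₀ := Real.exp (t * M) * Real.exp (t * F)
  have hblock : ∀ (θ : Θ) (x : State J), ∫⁻ y, V y ∂(nStep P θ m x) ≤
      ENNReal.ofReal (Real.exp (-α)) * V x + ENNReal.ofReal C₀ := by
    intro θ x
    by_cases hx : κ ≤ (size x : ℝ)
    · refine le_add_right ?_
      have h1 := lintegral_exp_le_of_integral_le (ν := nStep P θ m x)
        (Z := fun y => f y - f x) Measurable.of_discrete.aestronglyMeasurable
        (ae_nStep_abs_sub_le hφf θ m x) (hdrift θ x m hx (Nat.le_ceil σ)) ht htM htq
      calc ∫⁻ y, V y ∂(nStep P θ m x)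
          = ∫⁻ y, ENNReal.ofReal (Real.exp (t * (f y - f x))) * V x ∂(nStep P θ m x) := by
            refine lintegral_congr fun y => ?_
            simp only [hV]
            rw [← ENNReal.ofReal_mul (Real.exp_pos _).le, ← Real.exp_add]
            congr 2
            ring
        _ = (∫⁻ y, ENNReal.ofReal (Real.exp (t * (f y - f x))) ∂(nStep P θ m x)) * V x :=
            lintegral_mul_const _ Measurable.of_discrete
        _ ≤ _ := by gcongr
    · refine le_add_left ((lintegral_exp_nStep_le hφf ht θ m x).trans ?_)
      rw [← ENNReal.ofReal_mul (Real.exp_pos _).le]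
      refine ENNReal.ofReal_le_ofReal (mul_le_mul_of_nonneg_left
        (Real.exp_le_exp.2 (mul_le_mul_of_nonneg_left ?_ ht.le)) (Real.exp_pos _).le)
      exact hF ⟨x, not_le.1 hx, rfl⟩
  have hα1 : Real.exp (-α) < 1 := by simpa using hα0
  -- Fixed point of `C ↦ exp (-α) * C + C₀`, the geometric sum of the block errors.
  set C₁ := C₀ / (1 - Real.exp (-α)) with hC₁
  have hC₀ : 0 ≤ C₀ := by positivity
  have hC₁0 : 0 ≤ C₁ := div_nonneg hC₀ (by linarith)
  have hCC : ENNReal.ofReal (Real.exp (-α)) * ENNReal.ofReal C₁ + ENNReal.ofReal C₀ ≤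
      ENNReal.ofReal C₁ := by
    rw [← ENNReal.ofReal_mul (Real.exp_pos _).le, ← ENNReal.ofReal_add (by positivity) hC₀]
    refine ENNReal.ofReal_le_ofReal (le_of_eq ?_)
    have : C₁ * (1 - Real.exp (-α)) = C₀ := div_mul_cancel₀ _ (by linarith)
    linarith
  -- The rate `α * c / m` comes from contraction over about `c * f x / m` blocks, the rate `t` from
  -- dividing the constant `C₁` by `V x`.
  set β := min t (α * c / m) with hβ
  refine ⟨β, Real.exp (α / m + α) * Real.exp 1 + C₁, by positivity, by positivity, ?_⟩
  intro θ x
  set n := N x / m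
  set r := N x % m
  -- The incomplete block is run first; it multiplies `V x` by at most `exp (t * M) ≤ exp 1`.
  have hrn : N x = r + n * m := by rw [mul_comm]; exact (Nat.mod_add_div _ _).symm
  have hr : (r : ℝ) * φ ≤ M :=
    mul_le_mul_of_nonneg_right (by exact_mod_cast (Nat.mod_lt _ hm0).le) hφ.le
  -- The loss `α / m` is due to rounding `N x`, the loss `α` to the incomplete block.
  have hn : α * (c / m) * f x - (α / m + α) ≤ α * n := by
    have h1 := (abs_lt.1 (hN x)).1
    have h2 : (N x : ℝ) < (n + 1) * m := by
      have : N x < (n + 1) * m := by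
        have := Nat.mod_lt (N x) hm0
        rw [hrn, add_mul, one_mul]
        omega
      exact_mod_cast this
    have h3 : c * f x - 1 ≤ (n + 1) * m := by linarith
    have h4 := mul_le_mul_of_nonneg_left ((div_le_iff₀ hmR).2 h3) hα0.le
    calc α * (c / m) * f x - (α / m + α) = α * ((c * f x - 1) / m) - α := by ring
      _ ≤ α * n := by linarith
  have hVx : V x ≠ 0 := by simp [hV, Real.exp_pos]
  have hVx' : V x ≠ ∞ := ENNReal.ofReal_ne_top
  have hmarkov : V x * nStep P θ (N x) x {y | f x < f y} ≤
      ∫⁻ y, V y ∂(nStep P θ (N x) x) := by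
    refine le_trans ?_ (mul_meas_ge_le_lintegral₀ Measurable.of_discrete.aemeasurable (V x))
    gcongr
    rename_i y
    intro hy
    exact ENNReal.ofReal_le_ofReal
      (Real.exp_le_exp.2 (mul_le_mul_of_nonneg_left (le_of_lt hy) ht.le))
  have hmoment : ∫⁻ y, V y ∂(nStep P θ (N x) x) ≤
      V x * ENNReal.ofReal (Real.exp (-α) ^ n * Real.exp 1 + C₁ * Real.exp (-(t * f x))) := by
    calc ∫⁻ y, V y ∂(nStep P θ (N x) x)
        ≤ ∫⁻ z, (ENNReal.ofReal (Real.exp (-α)) ^ n * V z + ENNReal.ofReal C₁)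
            ∂(nStep P θ r x) := by
          rw [hrn, lintegral_nStep_add]
          exact lintegral_mono (lintegral_nStep_mul_le (hblock θ) hCC n)
      _ = ENNReal.ofReal (Real.exp (-α)) ^ n * ∫⁻ z, V z ∂(nStep P θ r x) +
            ENNReal.ofReal C₁ := by
          rw [lintegral_add_right _ measurable_const, lintegral_const_mul _ Measurable.of_discrete]
          simp
      _ ≤ ENNReal.ofReal (Real.exp (-α)) ^ n * (ENNReal.ofReal (Real.exp 1) * V x) +
            ENNReal.ofReal C₁ := by
          gcongr
          refine (lintegral_exp_nStep_le hφf ht θ r x).trans ?_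
          gcongr
          exact (mul_le_mul_of_nonneg_left hr ht.le).trans htM
      _ = _ := by
          simp only [hV]
          rw [← ENNReal.ofReal_pow (Real.exp_pos _).le, ← ENNReal.ofReal_mul (by positivity),
            ← ENNReal.ofReal_mul (by positivity), ← ENNReal.ofReal_add (by positivity) hC₁0,
            ← ENNReal.ofReal_mul (by positivity)]
          congr 1
          have : Real.exp (t * f x) * Real.exp (-(t * f x)) = 1 := by
            rw [← Real.exp_add]; simp
          linear_combination (-C₁) * this
  refine ((ENNReal.mul_le_mul_iff_right hVx hVx').1 (hmarkov.trans hmoment)).trans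
    (ENNReal.ofReal_le_ofReal ?_)
  have hβ1 : β * f x ≤ t * f x := mul_le_mul_of_nonneg_right (min_le_left _ _) (hf x)
  have hβ2 : β * f x ≤ α * (c / m) * f x := by
    rw [← mul_div_assoc]
    exact mul_le_mul_of_nonneg_right (min_le_right _ _) (hf x)
  rw [add_mul]
  refine add_le_add ?_ (mul_le_mul_of_nonneg_left (Real.exp_le_exp.2 (by linarith)) hC₁0)
  rw [← Real.exp_nat_mul, ← Real.exp_add, ← Real.exp_add, ← Real.exp_add]
  exact Real.exp_le_exp.2 (by linarith)

end NStep

/-! ### One iteration of the two search algorithms. -/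

section Search

variable {J : ℕ} {Θ : Type*} [MeasurableSpace Θ]

theorem metropolis_apply_le {η : ℝ} (hη : 0 < η) (f : State J → ℝ) (s s' : State J × Θ)
    (D : Set (State J)) :
    metropolis η f s s' (Prod.fst ⁻¹' D) ≤ D.indicator 1 s'.1 + D.indicator 1 s.1 := by
  have hD : MeasurableSet (Prod.fst ⁻¹' D : Set (State J × Θ)) :=
    measurable_fst MeasurableSet.of_discrete
  have h1 : Real.exp (η * min 0 (f s'.1 - f s.1)) ≤ 1 :=
    Real.exp_le_one_iff.2 (mul_nonpos_of_nonneg_of_nonpos hη.le (min_le_left _ _))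
  have h2 : 1 - Real.exp (η * min 0 (f s'.1 - f s.1)) ≤ 1 :=
    sub_le_self _ (Real.exp_pos _).le
  simp only [metropolis, Measure.add_apply, Measure.smul_apply, smul_eq_mul,
    Measure.dirac_apply' _ hD]
  have e (u : State J × Θ) : (Prod.fst ⁻¹' D : Set (State J × Θ)).indicator
      (1 : State J × Θ → ℝ≥0∞) u = D.indicator 1 u.1 := rfl
  rw [e, e]
  exact add_le_add (mul_le_of_le_one_left zero_le (ENNReal.ofReal_le_one.2 h1))
    (mul_le_of_le_one_left zero_le (ENNReal.ofReal_le_one.2 h2))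

theorem lintegral_le_of_measure_univ_le_one {α : Type*} [MeasurableSpace α] {U : Measure α}
    (hU : U Set.univ ≤ 1) {g : α → ℝ≥0∞} {b : ℝ≥0∞} (hg : ∀ a, g a ≤ b) : ∫⁻ a, g a ∂U ≤ b :=
  calc ∫⁻ a, g a ∂U ≤ ∫⁻ _, b ∂U := lintegral_mono hg
    _ = b * U Set.univ := lintegral_const b
    _ ≤ b := mul_le_of_le_one_right zero_le hU

variable {P : Kernel (Θ × State J) (State J)} {f : State J → ℝ} {η : ℝ}
  {N : State J → ℕ}

/-- Rejection stays at `s.1 ∉ D`, so only the proposal can enter `D`; the spare factor 2 matches the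
local search. -/
theorem globalStep_apply_le (hη : 0 < η) {U : Measure Θ} (hU : U Set.univ ≤ 1)
    (s : State J × Θ) {D : Set (State J)} (hs : s.1 ∉ D) {b : ℝ≥0∞}
    (hb : ∀ γ, nStep P γ (N s.1) s.1 D ≤ b) :
    globalStep P f η N U s (Prod.fst ⁻¹' D) ≤ 2 * b := by
  have hD : MeasurableSet (Prod.fst ⁻¹' D : Set (State J × Θ)) :=
    measurable_fst MeasurableSet.of_discrete
  refine (Measure.bind_apply_le _ hD).trans (lintegral_le_of_measure_univ_le_one hU fun γ => ?_)
  refine (Measure.bind_apply_le _ hD).trans ?_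
  calc _ ≤ ∫⁻ y, D.indicator 1 y ∂(nStep P γ (N s.1) s.1) :=
        lintegral_mono fun y => (metropolis_apply_le hη f s (y, γ) D).trans (by simp [hs])
    _ = nStep P γ (N s.1) s.1 D := lintegral_indicator_one MeasurableSet.of_discrete
    _ ≤ b := hb γ
    _ ≤ 2 * b := le_mul_of_one_le_left zero_le one_le_two

theorem measure_univ_cond_le_one {α : Type*} [MeasurableSpace α] (ν : Measure α) (s : Set α) :
    ProbabilityTheory.cond ν s Set.univ ≤ 1 := by
  simp [ProbabilityTheory.cond, ENNReal.inv_mul_le_one]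

/-- Union bound: the new state is one of the two endpoints `x'` and `y`. -/
theorem localStep_apply_le [IsMarkovKernel P] (hη : 0 < η) (B : Θ → Set Θ)
    (s : State J × Θ) {D : Set (State J)} {b : ℝ≥0∞}
    (hb : ∀ γ, nStep P γ (N s.1) s.1 D ≤ b) :
    localStep P f η N B s (Prod.fst ⁻¹' D) ≤ 2 * b := by
  have hD : MeasurableSet (Prod.fst ⁻¹' D : Set (State J × Θ)) :=
    measurable_fst MeasurableSet.of_discrete
  refine (Measure.bind_apply_le _ hD).trans
    (lintegral_le_of_measure_univ_le_one (measure_univ_cond_le_one _ _) fun γ => ?_)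
  refine (Measure.bind_apply_le _ hD).trans ?_
  calc _ ≤ ∫⁻ x', (b + D.indicator 1 x') ∂(nStep P s.2 (N s.1) s.1) := by
        refine lintegral_mono fun x' => (Measure.bind_apply_le _ hD).trans ?_
        calc _ ≤ ∫⁻ y, (D.indicator 1 y + D.indicator 1 x') ∂(nStep P γ (N s.1) s.1) :=
              lintegral_mono fun y => metropolis_apply_le hη f (x', s.2) (y, γ) D
          _ = nStep P γ (N s.1) s.1 D + D.indicator 1 x' := by
              rw [lintegral_add_right _ measurable_const,
                lintegral_indicator_one MeasurableSet.of_discrete]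
              simp
          _ ≤ b + D.indicator 1 x' := by gcongr; exact hb γ
    _ = b + nStep P s.2 (N s.1) s.1 D := by
        rw [lintegral_add_left measurable_const,
          lintegral_indicator_one MeasurableSet.of_discrete]
        simp
    _ ≤ 2 * b := by rw [two_mul]; gcongr; exact hb s.2

end Search

theorem uniformParam_univ_le_one {I : ℕ} {L : Set (Fin I → ℝ)} (hL : MeasurableSet L) :
    uniformParam L Set.univ ≤ 1 := by
  rw [uniformParam, (MeasurableEmbedding.subtype_coe hL).comap_apply]
  exact (measure_mono (Set.subset_univ _)).trans (measure_univ_cond_le_one _ _)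

/-! ### From one-step bounds to probabilities along the path. -/

section Path

variable {J : ℕ} {Θ : Type*} [MeasurableSpace Θ] {Ω : Type*} [mΩ : MeasurableSpace Ω]
  {μ : Measure Ω} [IsProbabilityMeasure μ] {ℱ : Filtration ℕ mΩ}
  {Q : State J × Θ → Measure (State J × Θ)} {S : ℕ → Ω → State J × Θ}

/-- A uniform bound on the one-step probability of a transition from `x ∈ G` into `D x` bounds
the probability that the chain makes such a transition at time `k`. -/
theorem IsMarkovChain.measure_transition_le (hS : IsMarkovChain μ ℱ Q S) (k : ℕ)
    (G : Set (State J)) (D : State J → Set (State J)) {b : ℝ≥0∞}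
    (hb : ∀ s : State J × Θ, s.1 ∈ G → Q s (Prod.fst ⁻¹' D s.1) ≤ b) :
    μ {ω | (S k ω).1 ∈ G ∧ (S (k + 1) ω).1 ∈ D (S k ω).1} ≤ b := by
  have hY : Measurable[ℱ k] fun ω => (S k ω).1 := measurable_fst.comp (hS.adapted k)
  have hY' : Measurable fun ω => (S k ω).1 := hY.mono (ℱ.le k) le_rfl
  -- Splitting over the countably many values of `Y_k` makes the target set `D x` deterministic on
  -- each piece.
  set E : State J → Set Ω := fun x => (fun ω => (S k ω).1) ⁻¹' {x}
  have hE : ∀ x, MeasurableSet (E x) := fun x => hY' (measurableSet_singleton x)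
  have hterm : ∀ x, μ ({ω | (S k ω).1 ∈ G ∧ (S (k + 1) ω).1 ∈ D (S k ω).1} ∩ E x) ≤
      b * μ (E x) := by
    intro x
    by_cases hx : x ∈ G
    · calc _ ≤ μ (E x ∩ S (k + 1) ⁻¹' (Prod.fst ⁻¹' D x)) := by
            refine measure_mono fun ω hω => ⟨hω.2, ?_⟩
            have h2 : (S k ω).1 = x := hω.2
            have h3 := hω.1.2
            rwa [h2] at h3
        _ = ∫⁻ ω in E x, Q (S k ω) (Prod.fst ⁻¹' D x) ∂μ :=
            hS.transition k _ (hY (measurableSet_singleton x)) _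
              (measurable_fst MeasurableSet.of_discrete)
        _ ≤ ∫⁻ _ in E x, b ∂μ := by
            refine setLIntegral_mono measurable_const fun ω hω => ?_
            have h2 : (S k ω).1 = x := hω
            have h3 := hb (S k ω) (h2 ▸ hx)
            rwa [h2] at h3
        _ = b * μ (E x) := setLIntegral_const _ _
    · refine le_of_eq_of_le ?_ zero_le
      convert measure_empty (μ := μ)
      ext ω
      simp only [Set.mem_inter_iff, Set.mem_ofPred_eq, Set.mem_empty_iff_false, iff_false]
      rintro ⟨⟨h1, -⟩, h2⟩
      have h2 : (S k ω).1 = x := h2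
      exact hx (h2 ▸ h1)
  have hun : (⋃ x, E x) = Set.univ := by
    ext ω; simp [E]
  calc μ {ω | (S k ω).1 ∈ G ∧ (S (k + 1) ω).1 ∈ D (S k ω).1}
      = μ (⋃ x, {ω | (S k ω).1 ∈ G ∧ (S (k + 1) ω).1 ∈ D (S k ω).1} ∩ E x) := by
        rw [← Set.inter_iUnion, hun, Set.inter_univ]
    _ ≤ ∑' x, b * μ (E x) := (measure_iUnion_le _).trans (ENNReal.tsum_le_tsum hterm)
    _ = b * μ (⋃ x, E x) := by
        rw [ENNReal.tsum_mul_left, measure_iUnion _ hE]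
        intro x y hxy
        exact (Set.disjoint_singleton.2 hxy).preimage _
    _ = b := by rw [hun, measure_univ, mul_one]

end Path

/-- A nonnegative sequence that grows at most affinely, and eventually only from values below
`R * log (k + 1)`, is `o(k)`. -/
theorem tendsto_div_natCast_of_eventually {u : ℕ → ℝ} (hu : ∀ k, 0 ≤ u k) {A b R : ℝ}
    (hA : 0 ≤ A) (hb : 0 ≤ b) (hR : 0 ≤ R) (hstep : ∀ k, u (k + 1) ≤ A * u k + b)
    (hev : ∀ᶠ k : ℕ in atTop, u k < R * Real.log (k + 1) ∨ u (k + 1) ≤ u k) :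
    Tendsto (fun k : ℕ => u k / k) atTop (𝓝 0) := by
  obtain ⟨K, hK⟩ := eventually_atTop.1 hev
  -- After time `K`, each rise starts below `R * log (k + 1)` and ends below `A` times that plus
  -- `b`; `u K` covers the time before the first rise.
  have hbound : ∀ k, K ≤ k → u k ≤ u K + b + A * R * Real.log (k + 1) := by
    intro k hk
    induction k, hk using Nat.le_induction with
    | base =>
      have : 0 ≤ A * R * Real.log (K + 1) :=
        mul_nonneg (mul_nonneg hA hR) (Real.log_nonneg (by linarith [K.cast_nonneg (α := ℝ)]))
      linarith
    | succ k hk ih =>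
      have hlog : Real.log ((k : ℝ) + 1) ≤ Real.log ((k + 1 : ℕ) + 1) :=
        Real.log_le_log (by positivity) (by push_cast; linarith)
      have hlog' := mul_le_mul_of_nonneg_left hlog (mul_nonneg hA hR)
      rcases hK k hk with h | h
      · have := mul_le_mul_of_nonneg_left h.le hA
        have := hstep k
        have := hu K
        linarith
      · linarith
  have hlim : Tendsto (fun k : ℕ => (u K + b) / k + A * R * (Real.log (k + 1) / k)) atTop
      (𝓝 0) := by
    have h1 : Tendsto (fun k : ℕ => (u K + b) / (k : ℝ)) atTop (𝓝 0) :=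
      tendsto_const_div_atTop_nhds_zero_nat _
    have h2 : Tendsto (fun k : ℕ => Real.log ((k : ℝ) + 1) / k) atTop (𝓝 0) := by
      have h3 : Tendsto (fun k : ℕ => Real.log ((k : ℝ) + 1) / ((k : ℝ) + 1)) atTop (𝓝 0) :=
        (Real.isLittleO_log_id_atTop.tendsto_div_nhds_zero).comp
          (tendsto_natCast_atTop_atTop.atTop_add tendsto_const_nhds)
      have h4 : Tendsto (fun k : ℕ => 1 + 1 / (k : ℝ)) atTop (𝓝 (1 + 0)) :=
        tendsto_const_nhds.add tendsto_one_div_atTop_nhds_zero_nat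
      have h5 := h3.mul h4
      rw [zero_mul] at h5
      refine h5.congr' ?_
      filter_upwards [eventually_gt_atTop 0] with k hk
      have : (0 : ℝ) < k := by exact_mod_cast hk
      field_simp
    simpa using h1.add (h2.const_mul (A * R))
  refine squeeze_zero' (Eventually.of_forall fun k => div_nonneg (hu k) k.cast_nonneg) ?_ hlim
  filter_upwards [eventually_ge_atTop K] with k hk
  rw [← mul_div_assoc, ← add_div]
  exact div_le_div_of_nonneg_right (hbound k hk) k.cast_nonneg

/-! ### Borel–Cantelli and the limit. -/

section Convergence

variable {J : ℕ} {Θ : Type*} [MeasurableSpace Θ] {Ω : Type*} [mΩ : MeasurableSpace Ω]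
  {μ : Measure Ω} [IsProbabilityMeasure μ] {ℱ : Filtration ℕ mΩ}
  {Q : State J × Θ → Measure (State J × Θ)} {S : ℕ → Ω → State J × Θ}

/-- `hQ` is all that is needed of the algorithm, so both searches are treated at once. -/
theorem IsMarkovChain.ae_tendsto_div (hS : IsMarkovChain μ ℱ Q S)
    {P : Kernel (Θ × State J) (State J)} [IsMarkovKernel P]
    {f : State J → ℝ} (hf : ∀ x, 0 ≤ f x) (hinc : BoundedIncrements P f)
    (hstable : IsFStable P f) {c d : ℝ} (hc : 0 < c) (hd : 0 < d) {N : State J → ℕ}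
    (hN : ∀ x, |(N x : ℝ) - (c * f x + d)| < 1)
    (hQ : ∀ (s : State J × Θ) (D : Set (State J)) (b : ℝ≥0∞), s.1 ∉ D →
      (∀ γ, nStep P γ (N s.1) s.1 D ≤ b) → Q s (Prod.fst ⁻¹' D) ≤ 2 * b) :
    ∀ᵐ ω ∂μ, Tendsto
      (fun k => f (S k ω).1 / totalTime (fun x => c * f x + d) (fun i => (S i ω).1) k)
      atTop (𝓝 0) := by
  obtain ⟨β, C, hβ, hC, hup⟩ := exists_nStep_gt_le hf hinc hstable hc hd hN
  obtain ⟨φ, hφ, hφf⟩ := hinc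
  have hstep : ∀ᵐ ω ∂μ, ∀ k,
      f (S (k + 1) ω).1 ≤ (1 + c * φ) * f (S k ω).1 + (d + 1) * φ := by
    refine ae_all_iff.2 fun k => ?_
    -- With `b = 0`: `N x ≤ c * f x + d + 1` steps of size at most `φ` almost surely cannot exceed
    -- the affine bound.
    have h := hS.measure_transition_le k Set.univ
      (fun x => {y | (1 + c * φ) * f x + (d + 1) * φ < f y}) (b := 0) (fun s _ => ?_)
    · rw [ae_iff]
      refine le_antisymm (le_trans (measure_mono fun ω hω => ?_) h) zero_le
      exact ⟨Set.mem_univ _, not_le.1 hω⟩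
    · rw [← mul_zero 2]
      refine hQ s _ 0 ?_ fun γ => le_of_eq ?_
      · have h1 := mul_nonneg (mul_nonneg hc.le hφ.le) (hf s.1)
        have h2 : 0 ≤ (d + 1) * φ := by positivity
        simp only [Set.mem_ofPred_eq, not_lt]
        linarith
      · refine measure_mono_null (fun y hy => ?_)
          (ae_iff.1 (ae_nStep_abs_sub_le hφf γ (N s.1) s.1))
        simp only [Set.mem_ofPred_eq, not_le] at hy ⊢
        have h1 := (abs_lt.1 (hN s.1)).2
        have h2 : (N s.1 : ℝ) * φ ≤ (c * f s.1 + d + 1) * φ :=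
          mul_le_mul_of_nonneg_right (by linarith) hφ.le
        have h3 := le_abs_self (f y - f s.1)
        linarith
  -- The factor `2 / β` turns `exp (-(β * f x))` into the summable `(k + 1) ^ (-2)`.
  have hev : ∀ᵐ ω ∂μ, ∀ᶠ k : ℕ in atTop,
      f (S k ω).1 < 2 / β * Real.log (k + 1) ∨ f (S (k + 1) ω).1 ≤ f (S k ω).1 := by
    have hbd : ∀ k : ℕ, μ {ω | (S k ω).1 ∈ {x | 2 / β * Real.log (k + 1) ≤ f x} ∧
        (S (k + 1) ω).1 ∈ {y | f (S k ω).1 < f y}} ≤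
        ENNReal.ofReal (2 * C * (1 / ((k : ℝ) + 1) ^ 2)) := by
      intro k
      refine hS.measure_transition_le k {x | 2 / β * Real.log (k + 1) ≤ f x}
        (fun x => {y | f x < f y}) fun s hs => ?_
      rw [mul_assoc, ENNReal.ofReal_mul zero_le_two, ENNReal.ofReal_ofNat]
      refine hQ s _ _ (by simp) fun γ => (hup γ s.1).trans (ENNReal.ofReal_le_ofReal ?_)
      refine mul_le_mul_of_nonneg_left ?_ hC
      have hk : (0 : ℝ) < (k : ℝ) + 1 := by positivity
      have h1 : 2 * Real.log ((k : ℝ) + 1) ≤ β * f s.1 := by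
        have := mul_le_mul_of_nonneg_left (show _ ≤ _ from hs) hβ.le
        rwa [← mul_assoc, mul_div_cancel₀ _ hβ.ne'] at this
      calc Real.exp (-(β * f s.1)) ≤ Real.exp (-(2 * Real.log ((k : ℝ) + 1))) :=
            Real.exp_le_exp.2 (by linarith)
        _ = 1 / ((k : ℝ) + 1) ^ 2 := by
            rw [Real.exp_neg, two_mul, Real.exp_add, Real.exp_log hk, one_div, sq]
    have hsum : Summable fun k : ℕ => 2 * C * (1 / ((k : ℝ) + 1) ^ 2) := by
      refine Summable.mul_left _ ?_
      have := (summable_nat_add_iff 1).2 (Real.summable_one_div_nat_pow.2 one_lt_two)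
      simpa using this
    filter_upwards [ae_eventually_notMem
      (ne_top_of_le_ne_top hsum.tsum_ofReal_ne_top (ENNReal.tsum_le_tsum hbd))] with ω hω
    filter_upwards [hω] with k hk
    by_contra! h
    exact hk ⟨h.1, h.2⟩
  filter_upwards [hstep, hev] with ω h1 h2
  have hlim := (tendsto_div_natCast_of_eventually (u := fun k => f (S k ω).1) (fun k => hf _)
    (by positivity) (by positivity) (by positivity) h1 h2).div_const d
  rw [zero_div] at hlim
  have hT : ∀ k : ℕ, k * d ≤ totalTime (fun x => c * f x + d) (fun i => (S i ω).1) k := by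
    intro k
    have := Finset.card_nsmul_le_sum (Finset.range k) (fun i => c * f (S i ω).1 + d) d
      (fun i _ => by linarith [mul_nonneg hc.le (hf (S i ω).1)])
    simpa [totalTime] using this
  refine squeeze_zero' (Eventually.of_forall fun k => ?_) ?_ hlim
  · exact div_nonneg (hf _) ((by positivity : (0 : ℝ) ≤ k * d).trans (hT k))
  · filter_upwards [eventually_gt_atTop 0] with k hk
    have : (0 : ℝ) < k * d := by positivity
    rw [div_div]
    exact div_le_div_of_nonneg_left (hf _) this (hT k)

end Convergence

end StabilitySearch

theorem theorem1 {I J : ℕ}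
    -- parameter set and family of Markov chains
    (L : Set (Fin I → ℝ)) (P : Kernel (L × StabilitySearch.State J) (StabilitySearch.State J))
    [IsMarkovKernel P]
    -- Lyapunov function
    (f : StabilitySearch.State J → ℝ) (hf : ∀ x, 0 ≤ f x)
    (hinc : StabilitySearch.BoundedIncrements P f)
    (hstable : StabilitySearch.IsFStable P f)
    -- user's choices: `τ(x) = c f(x) + d`, rounded to the number `N(x)` of simulated steps
    (η c d : ℝ) (hη : 0 < η) (hc : 0 < c) (hd : 0 < d)
    (N : StabilitySearch.State J → ℕ) (hN : ∀ x, |(N x : ℝ) - (c * f x + d)| < 1)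
    -- the process `S k = (Y_k, Λ_k)`
    {Ω : Type*} [mΩ : MeasurableSpace Ω] (μ : Measure Ω) [IsProbabilityMeasure μ]
    (ℱ : Filtration ℕ mΩ) (S : ℕ → Ω → StabilitySearch.State J × L) :
    -- global search
    ((MeasurableSet L → volume L ≠ 0 → volume L ≠ ∞ →
        StabilitySearch.IsMarkovChain μ ℱ
          (StabilitySearch.globalStep P f η N (StabilitySearch.uniformParam L)) S →
        ∀ᵐ ω ∂μ, Tendsto
          (fun k => f (S k ω).1 /
            StabilitySearch.totalTime (fun x => c * f x + d) (fun i => (S i ω).1) k)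
          atTop (𝓝 0)) ∧
    -- local search
      (L.Finite → ∀ B : L → Set L, (∀ l, l ∈ B l) →
        StabilitySearch.IsMarkovChain μ ℱ (StabilitySearch.localStep P f η N B) S →
        ∀ᵐ ω ∂μ, Tendsto
          (fun k => f (S k ω).1 /
            StabilitySearch.totalTime (fun x => c * f x + d) (fun i => (S i ω).1) k)
          atTop (𝓝 0))) := by
  refine ⟨fun hL _ _ hS => ?_, fun _ B _ hS => ?_⟩
  · exact hS.ae_tendsto_div hf hinc hstable hc hd hN fun s D b hs hb =>
      StabilitySearch.globalStep_apply_le hη (StabilitySearch.uniformParam_univ_le_one hL) s hs hb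
  · exact hS.ae_tendsto_div hf hinc hstable hc hd hN fun s D b _ hb =>
      StabilitySearch.localStep_apply_le hη B s hb
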